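/- Let $n\ge 1$ and identify $\mathbb{C}^n\cong\mathbb{R}^{2n}$, with Euclidean inner product $\langle\cdot,\cdot\rangle$ and Lebesgue measure $dx$. A \emph{star body} in $\mathbb{C}^n$ is a compact set $L$, star-shaped around the origin, whose radial function $\rho_L(u)=\sup\{t\ge 0: tu\in L\}$ is positive and continuous on $\mathbb{C}^n\setminus\{0\}$. For $C\in\mathcal{K}_{(0)}(\mathbb{C})$, that is, a compact convex set $C\subset\mathbb{C}$ with the origin in its interior, for a non-zero real $p>-2$, and for a star body $K\subset\mathbb{C}^n$, the \emph{complex $L_p$-intersection body} $\mathrm{I}_{C,p}K$ is the star body determined by $$\rho_{\mathrm{I}_{C,p}K}(u)^{-p}=\int_K h_{Cu}(x)^p\,dx\quad\text{for all unit vectors }u\in\mathbb{C}^n,\qquad h_{Cu}(x)=\sup_{c\in C}\langle cu,x\rangle .$$ An \emph{origin-symmetric ellipsoid} is the image of the closed Euclidean unit ball under an invertible real-linear map of $\mathbb{C}^n$, and $K$ is \emph{$\mathbb{S}^1$-invariant} if $cK=K$ for all $c\in\mathbb{C}$ with $|c|=1$. \textbf{Proposition.} For every $n\ge 1$ and every non-zero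 real $p$ with $-1\le p<1$, there exist $C\in\mathcal{K}_{(0)}(\mathbb{C})$, which can be chosen to be a triangle, and an origin-symmetric ellipsoid $K\subset\mathbb{C}^n$ that is not $\mathbb{S}^1$-invariant, such that the star body $\mathrm{I}_{C,p}K$ is well defined and not convex. Here $K$ is in particular a convex star body; hence, for $-1\le p<1$, $p\ne0$, the assumption of $\mathbb{S}^1$-invariance cannot be dropped in the theorem that $\mathrm{I}_{C,p}K$ is convex for every $C\in\mathcal{K}_{(0)}(\mathbb{C})$ and every convex, $\mathbb{S}^1$-invariant star body $K\subset\mathbb{C}^n$. -/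

import Mathlib

open MeasureTheory
open scoped Pointwise

noncomputable section

namespace ComplexLpIntersection

section RealInner

variable {E : Type*} [NormedAddCommGroup E] [InnerProductSpace ℝ E]

/-- The support function `h_K(u) = sup {⟨x, u⟩ : x ∈ K}`. -/
def supportFunction (K : Set E) (u : E) : ℝ :=
  sSup ((fun x : E => inner ℝ x u) '' K)

/-- The radial function `ρ_K(u) = sup {t ≥ 0 : t u ∈ K}`. -/
def radialFunction (K : Set E) (u : E) : ℝ :=
  sSup {t : ℝ | 0 ≤ t ∧ t • u ∈ K}

/-- Star bodies: compact sets, star-shaped around the origin, whose radial function is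
positive and continuous away from the origin. -/
structure IsStarBody (K : Set E) : Prop where
  isCompact : IsCompact K
  starConvex : StarConvex ℝ 0 K
  radial_pos : ∀ u : E, u ≠ 0 → 0 < radialFunction K u
  radial_continuousOn : ContinuousOn (radialFunction K) {u : E | u ≠ 0}

/-- Origin-symmetric (nondegenerate) ellipsoids: images of the Euclidean unit ball under
invertible real-linear maps. -/
def IsOriginSymmetricEllipsoid (K : Set E) : Prop :=
  ∃ A : E ≃L[ℝ] E, K = A '' Metric.closedBall (0 : E) 1

end RealInner

/-- `ℂⁿ` with its Euclidean structure. The real inner product is the one of `ℂⁿ ≅ ℝ²ⁿ`, and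
`volume` is the `2n`-dimensional Lebesgue measure. -/
abbrev Cn (n : ℕ) : Type := EuclideanSpace ℂ (Fin n)

/-- `cK = K` for every complex number `c` of modulus one. -/
def IsCircleInvariant {n : ℕ} (K : Set (Cn n)) : Prop :=
  ∀ c : ℂ, ‖c‖ = 1 → c • K = K

/-- `C` is a (nondegenerate) triangle in the complex plane. -/
def IsTriangle (C : Set ℂ) : Prop :=
  ∃ v : Fin 3 → ℂ, AffineIndependent ℝ v ∧ C = convexHull ℝ (Set.range v)

/-- `L` is the complex `L_p`-intersection body `I_{C,p} K`: the star body whose radial function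
satisfies `ρ_L(u) ^ (-p) = ∫_K h_{Cu}(x) ^ p dx` for all unit vectors `u`, where
`Cu = {c u : c ∈ C}`. A star body is determined by its radial function, so there is at most one
such `L`. As the left-hand side is positive, the integral on the right is then finite. -/
structure IsComplexLpIntersectionBody {n : ℕ} (C : Set ℂ) (p : ℝ) (K L : Set (Cn n)) : Prop where
  isStarBody : IsStarBody L
  radial_eq : ∀ u : Cn n, ‖u‖ = 1 →
    radialFunction L u ^ (-p) =
      ∫ x in K, supportFunction ((fun c : ℂ => c • u) '' C) x ^ p

end ComplexLpIntersection

end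

noncomputable section

namespace ComplexLpIntersection

open Filter Topology

/-! Let `h` be the support function of the triangle, and stretch the unit ball of `ℂⁿ` along the
real axis of one coordinate `j`. Since `p ≥ -1`, the integrals of `‖x j‖ ^ p` over these ellipsoids
diverge (`tendsto_integral_longEllipsoid`), while the points with bounded `x j` contribute only a
bounded amount. After normalisation only the directions `x j = ±1` survive. As the ellipsoids are
symmetric, both count equally, so on the `j`-th complex line the `p`-th power of the gauge of the
body tends to `(h (star z) ^ p + h (-star z) ^ p) / 2` (`tendsto_supportPowerIntegral_div`).

If all these bodies were convex, the limiting gauge would be subadditive. For `z = 2 + i` and `w = 1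
+ 2i` the pairs `(h (star ·), h (-star ·))` are `(2, 1)` and `(1, 2)`, and `z + w` gives their sum
`(3, 3)`. For `p < 1` the reverse Minkowski inequality is strict on these pairs
(`not_subadditive_of_lt_one`), a contradiction. Hence some finite stretch already gives a non-convex
body.

That the body exists needs continuity of the singular integral on the unit sphere
(`continuousOn_supportPowerIntegral`). -/

/-! ### The triangle and its support function -/

/-- The triangle with vertices `1`, `i` and `-1 - i`. -/
def triangleVertices : Fin 3 → ℂ := ![1, Complex.I, -1 - Complex.I]

/-- The support function of the triangle with vertices `1`, `i` and `-1 - i`. -/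
def triangleSupport (w : ℂ) : ℝ := max w.re (max w.im (-w.re - w.im))

lemma affineIndependent_triangleVertices : AffineIndependent ℝ triangleVertices := by
  rw [affineIndependent_iff_of_fintype]
  intro w hw hs
  rw [Finset.weightedVSub_eq_weightedVSubOfPoint_of_sum_eq_zero _ w triangleVertices hw 0] at hs
  simp only [Finset.weightedVSubOfPoint_apply, Fin.sum_univ_three, triangleVertices] at hs hw
  have h1 := congrArg Complex.re hs
  have h2 := congrArg Complex.im hs
  simp at h1 h2
  intro i
  fin_cases i <;> simp <;> linarith

lemma ball_subset_triangle :
    Metric.ball (0 : ℂ) (1 / 3) ⊆ convexHull ℝ (Set.range triangleVertices) := by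
  intro z hz
  rw [mem_ball_zero_iff] at hz
  have h1 := (abs_lt.1 ((Complex.abs_re_le_norm z).trans_lt hz))
  have h2 := (abs_lt.1 ((Complex.abs_im_le_norm z).trans_lt hz))
  have h3 : ∀ i, triangleVertices i ∈ convexHull ℝ (Set.range triangleVertices) :=
    fun i => subset_convexHull _ _ ⟨i, rfl⟩
  have hc := convex_convexHull ℝ (Set.range triangleVertices)
  -- The weights are the barycentric coordinates of `z`; they are nonnegative because both `|z.re|`
  -- and `|z.im|` are below `1/3`.
  have := hc.sum_mem (t := Finset.univ)
    (w := ![(1 + 2 * z.re - z.im) / 3, (1 - z.re + 2 * z.im) / 3, (1 - z.re - z.im) / 3])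
    (z := triangleVertices) (by
      intro i _
      fin_cases i <;> simp <;> linarith [h1.1, h1.2, h2.1, h2.2])
    (by simp [Fin.sum_univ_three]; ring) (fun i _ => h3 i)
  convert this using 1
  simp only [Fin.sum_univ_three, triangleVertices]
  apply Complex.ext <;> simp <;> ring

/-- The triangle with vertices `1`, `i` and `-1 - i` as a convex body. -/
def triangleBody : ConvexBody ℂ where
  carrier := convexHull ℝ (Set.range triangleVertices)
  convex' := convex_convexHull _ _
  isCompact' := (Set.finite_range _).isCompact_convexHull ℝ
  nonempty' := (Set.range_nonempty _).convexHull

lemma zero_mem_interior_triangleBody : (0 : ℂ) ∈ interior (triangleBody : Set ℂ) :=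
  mem_interior.2 ⟨_, ball_subset_triangle, Metric.isOpen_ball, by simp⟩

lemma isTriangle_triangleBody : IsTriangle (triangleBody : Set ℂ) :=
  ⟨_, affineIndependent_triangleVertices, rfl⟩

lemma real_inner_smul_eq {n : ℕ} (c : ℂ) (u x : Cn n) :
    inner ℝ (c • u) x = c.re * (inner ℂ u x).re + c.im * (inner ℂ u x).im := by
  simp only [PiLp.inner_apply, PiLp.smul_apply, Complex.re_sum, Complex.im_sum, Finset.mul_sum,
    ← Finset.sum_add_distrib]
  refine Finset.sum_congr rfl fun i _ => ?_
  simp [Complex.inner]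
  ring

lemma supportFunction_triangle {n : ℕ} (u x : Cn n) :
    supportFunction ((fun c : ℂ => c • u) '' (triangleBody : Set ℂ)) x =
      triangleSupport (inner ℂ u x) := by
  set w : ℂ := inner ℂ u x
  refine IsGreatest.csSup_eq ⟨?_, ?_⟩
  · have h3 : ∀ i, triangleVertices i ∈ (triangleBody : Set ℂ) :=
      fun i => subset_convexHull _ _ ⟨i, rfl⟩
    rw [Set.image_image]
    simp only [real_inner_smul_eq]
    rcases max_choice w.re (max w.im (-w.re - w.im)) with h | h
    · refine ⟨_, h3 0, Eq.trans ?_ h.symm⟩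
      simp [triangleVertices, w]
    · rcases max_choice w.im (-w.re - w.im) with h' | h'
      · refine ⟨_, h3 1, Eq.trans ?_ (h.trans h').symm⟩
        simp [triangleVertices, w]
      · refine ⟨_, h3 2, Eq.trans ?_ (h.trans h').symm⟩
        simp [triangleVertices, w]
        ring
  · rintro _ ⟨_, ⟨c, hc, rfl⟩, rfl⟩
    simp only [real_inner_smul_eq]
    change _ ≤ triangleSupport w
    have hconv : Convex ℝ {c : ℂ | c.re * w.re + c.im * w.im ≤ triangleSupport w} := by
      intro a ha b hb s t hs ht hst
      simp only [Set.mem_ofPred_eq] at *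
      have := add_le_add (mul_le_mul_of_nonneg_left ha hs) (mul_le_mul_of_nonneg_left hb ht)
      rw [← add_mul, hst, one_mul] at this
      simp
      linarith
    refine convexHull_min ?_ hconv hc
    rintro _ ⟨i, rfl⟩
    fin_cases i
    · simp [triangleVertices, triangleSupport]
    · simp [triangleVertices, triangleSupport]
    · simp [triangleVertices, triangleSupport]

lemma continuous_triangleSupport : Continuous triangleSupport := by
  unfold triangleSupport
  fun_prop

lemma triangleSupport_smul {t : ℝ} (ht : 0 ≤ t) (w : ℂ) :
    triangleSupport (t • w) = t * triangleSupport w := by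
  simp only [triangleSupport, mul_max_of_nonneg _ _ ht, Complex.smul_re, Complex.smul_im,
    smul_eq_mul]
  congr 2
  ring

/-- The three linear forms in the maximum sum to zero, so an upper bound `s` on all of them forces
each to be at least `-2 * s`. -/
lemma norm_le_triangleSupport (w : ℂ) : ‖w‖ / 4 ≤ triangleSupport w := by
  have h1 : w.re ≤ triangleSupport w := le_max_left _ _
  have h2 : w.im ≤ triangleSupport w := (le_max_left _ _).trans (le_max_right _ _)
  have h3 : -w.re - w.im ≤ triangleSupport w := (le_max_right _ _).trans (le_max_right _ _)
  have h4 : |w.re| ≤ 2 * triangleSupport w := abs_le.2 ⟨by linarith, by linarith⟩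
  have h5 : |w.im| ≤ 2 * triangleSupport w := abs_le.2 ⟨by linarith, by linarith⟩
  linarith [Complex.norm_le_abs_re_add_abs_im w]

lemma triangleSupport_le (w : ℂ) : triangleSupport w ≤ 2 * ‖w‖ := by
  have h1 := abs_le.1 (Complex.abs_re_le_norm w)
  have h2 := abs_le.1 (Complex.abs_im_le_norm w)
  have h3 := norm_nonneg w
  exact max_le (by linarith [h1.2]) (max_le (by linarith [h2.2]) (by linarith [h1.1, h2.1]))

lemma triangleSupport_nonneg (w : ℂ) : 0 ≤ triangleSupport w :=
  (by positivity : (0 : ℝ) ≤ ‖w‖ / 4).trans (norm_le_triangleSupport w)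

lemma triangleSupport_pos {w : ℂ} (hw : w ≠ 0) : 0 < triangleSupport w :=
  (by positivity : (0 : ℝ) < ‖w‖ / 4).trans_le (norm_le_triangleSupport w)

lemma triangleSupport_zero : triangleSupport 0 = 0 := by simp [triangleSupport]

lemma triangleSupport_rpow_le (p : ℝ) (w : ℂ) :
    triangleSupport w ^ p ≤ 4 ^ |p| * ‖w‖ ^ p := by
  rcases eq_or_ne w 0 with rfl | hw
  · rw [triangleSupport_zero, norm_zero]
    exact le_mul_of_one_le_left (Real.rpow_nonneg le_rfl _)
      (Real.one_le_rpow (by norm_num) (abs_nonneg _))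
  have hw' : 0 < ‖w‖ := norm_pos_iff.2 hw
  rcases le_total 0 p with hp | hp
  · rw [abs_of_nonneg hp, ← Real.mul_rpow (by norm_num) hw'.le]
    exact Real.rpow_le_rpow (triangleSupport_nonneg w)
      ((triangleSupport_le w).trans (by linarith)) hp
  · rw [abs_of_nonpos hp, Real.rpow_neg (by norm_num), ← Real.inv_rpow (by norm_num),
      ← Real.mul_rpow (by norm_num) hw'.le]
    exact Real.rpow_le_rpow_of_nonpos (by positivity)
      (by linarith [norm_le_triangleSupport w]) hp

/-! ### The strict power inequality for `p < 1` -/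

/-- The limiting gauge is not subadditive. -/
lemma not_subadditive_of_lt_one {p : ℝ} (hp1 : p < 1) (hp0 : p ≠ 0) :
    2 * (2 ^ p + 1 : ℝ) ^ p⁻¹ < (3 ^ p + 3 ^ p : ℝ) ^ p⁻¹ := by
  have h2 : (2 : ℝ) = ((2 : ℝ) ^ p) ^ p⁻¹ := by
    rw [← Real.rpow_mul (by norm_num), mul_inv_cancel₀ hp0, Real.rpow_one]
  have hmul : 2 * (2 ^ p + 1 : ℝ) ^ p⁻¹ = (2 ^ p * (2 ^ p + 1) : ℝ) ^ p⁻¹ := by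
    rw [Real.mul_rpow (by positivity) (by positivity), ← h2]
  have h3 : (3 : ℝ) ^ p = 2 ^ p * (3 / 2) ^ p := by
    rw [← Real.mul_rpow (by norm_num) (by norm_num)]
    norm_num
  have h2p : (0 : ℝ) < 2 ^ p := by positivity
  rw [hmul, h3]
  rcases lt_or_gt_of_ne hp0 with hp | hp
  · refine Real.rpow_lt_rpow_of_neg (by positivity) ?_ (inv_lt_zero.2 hp)
    -- The arithmetic mean `3/2` of `1` and `2` exceeds their geometric mean `√2`; AM-GM for `2 ^ p`
    -- and `1` then bounds `2 * √2 ^ p`.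
    have hs : (3 / 2 : ℝ) ^ p < Real.sqrt 2 ^ p := by
      refine Real.rpow_lt_rpow_of_neg (by positivity) ?_ hp
      rw [Real.sqrt_lt' (by norm_num)]
      norm_num
    have hs2 : Real.sqrt 2 ^ p * Real.sqrt 2 ^ p = 2 ^ p := by
      rw [← Real.mul_rpow (by positivity) (by positivity), Real.mul_self_sqrt (by norm_num)]
    have : (3 / 2 : ℝ) ^ p + (3 / 2) ^ p < 2 ^ p + 1 := by
      nlinarith [sq_nonneg (Real.sqrt 2 ^ p - 1)]
    nlinarith
  · refine Real.rpow_lt_rpow (by positivity) ?_ (inv_pos.2 hp)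
    -- For `0 < p < 1`, strict concavity of the power at the midpoint `3/2` of `1` and `2` suffices.
    have := (Real.strictConcaveOn_rpow hp hp1).2 (Set.mem_Ici.2 zero_le_two)
      (Set.mem_Ici.2 zero_le_one) (by norm_num) (one_half_pos (α := ℝ)) (one_half_pos (α := ℝ))
      (add_halves 1)
    norm_num at this
    nlinarith

/-! ### Star bodies as sublevel sets of positively homogeneous functions -/

section Gauge

variable {E : Type*} [NormedAddCommGroup E] [InnerProductSpace ℝ E]

lemma radialFunction_sublevel {N : E → ℝ} (hpos : ∀ x, x ≠ 0 → 0 < N x)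
    (hhom : ∀ (t : ℝ) (x : E), 0 < t → N (t • x) = t * N x) {u : E} (hu : u ≠ 0) :
    radialFunction {x | N x ≤ 1} u = (N u)⁻¹ := by
  refine IsGreatest.csSup_eq ⟨⟨(inv_pos.2 (hpos u hu)).le, ?_⟩, ?_⟩
  · rw [Set.mem_ofPred_eq, hhom _ _ (inv_pos.2 (hpos u hu)), inv_mul_cancel₀ (hpos u hu).ne']
  · rintro t ⟨ht, htu⟩
    rcases ht.eq_or_lt with rfl | ht
    · exact (inv_pos.2 (hpos u hu)).le
    · rw [Set.mem_ofPred_eq, hhom _ _ ht] at htu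
      rwa [inv_eq_one_div, le_div_iff₀ (hpos u hu)]

/-- Homogeneity carries continuity and two-sided bounds from the compact unit sphere to the whole
space: the lower bound gives compactness, the upper one continuity at the origin. -/
lemma isStarBody_sublevel [FiniteDimensional ℝ E] {N : E → ℝ} (hpos : ∀ x, x ≠ 0 → 0 < N x)
    (h0 : N 0 = 0) (hhom : ∀ (t : ℝ) (x : E), 0 < t → N (t • x) = t * N x)
    (hcont : ContinuousOn N (Metric.sphere 0 1)) :
    IsStarBody {x | N x ≤ 1} := by
  have hprod : ∀ x : E, x ≠ 0 → N x = ‖x‖ * N (‖x‖⁻¹ • x) := by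
    intro x hx
    rw [← hhom _ _ (norm_pos_iff.2 hx), smul_smul, mul_inv_cancel₀ (norm_ne_zero_iff.2 hx),
      one_smul]
  have hmem : ∀ x : E, x ≠ 0 → ‖x‖⁻¹ • x ∈ Metric.sphere (0 : E) 1 := by
    intro x hx
    rw [mem_sphere_zero_iff_norm, norm_smul, norm_inv, norm_norm,
      inv_mul_cancel₀ (norm_ne_zero_iff.2 hx)]
  have hc : ContinuousOn N {u : E | u ≠ 0} := by
    refine ContinuousOn.congr (f := fun x => ‖x‖ * N (‖x‖⁻¹ • x)) ?_ hprod
    refine continuous_norm.continuousOn.mul (hcont.comp ?_ hmem)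
    exact (continuous_norm.continuousOn.inv₀ fun x hx => norm_ne_zero_iff.2 hx).smul
      continuousOn_id
  have hsph : IsCompact (Metric.sphere (0 : E) 1) := isCompact_sphere _ _
  obtain ⟨c, hc0, hcN⟩ : ∃ c > 0, ∀ x : E, c * ‖x‖ ≤ N x := by
    rcases (Metric.sphere (0 : E) 1).eq_empty_or_nonempty with he | hne
    · refine ⟨1, one_pos, fun x => ?_⟩
      rcases eq_or_ne x 0 with rfl | hx
      · simp [h0]
      · exact absurd (hmem x hx) (by simp [he])
    · obtain ⟨v, hv, hmin⟩ := hsph.exists_isMinOn hne hcont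
      have hv0 : v ≠ 0 := by
        rintro rfl
        simp at hv
      refine ⟨N v, hpos v hv0, fun x => ?_⟩
      rcases eq_or_ne x 0 with rfl | hx
      · simp [h0]
      · rw [hprod x hx, mul_comm]
        exact mul_le_mul_of_nonneg_left (hmin (hmem x hx)) (norm_nonneg x)
  obtain ⟨B, hB⟩ : ∃ B, ∀ x ∈ Metric.sphere (0 : E) 1, ‖N x‖ ≤ B :=
    hsph.exists_bound_of_continuousOn hcont
  have hBN : ∀ x : E, ‖N x‖ ≤ ‖x‖ * B := by
    intro x
    rcases eq_or_ne x 0 with rfl | hx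
    · simp [h0]
    · rw [hprod x hx, norm_mul, norm_norm]
      exact mul_le_mul_of_nonneg_left (hB _ (hmem x hx)) (norm_nonneg x)
  have hN : Continuous N := by
    rw [continuous_iff_continuousAt]
    intro x
    rcases eq_or_ne x 0 with rfl | hx
    · rw [ContinuousAt, h0]
      refine squeeze_zero_norm hBN ?_
      have : Continuous fun x : E => ‖x‖ * B := by fun_prop
      simpa using this.tendsto 0
    · exact hc.continuousAt (isOpen_ne.mem_nhds hx)
  refine ⟨?_, ?_, ?_, ?_⟩
  · refine (isCompact_closedBall (0 : E) c⁻¹).of_isClosed_subset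
      (isClosed_le hN continuous_const) fun x hx => ?_
    rw [mem_closedBall_zero_iff, inv_eq_one_div, le_div_iff₀ hc0, mul_comm]
    exact (hcN x).trans hx
  · rw [starConvex_zero_iff]
    intro x hx a ha ha1
    rcases ha.eq_or_lt with rfl | ha
    · simp [h0]
    · rw [Set.mem_ofPred_eq, hhom _ _ ha]
      have : 0 ≤ N x := (by positivity : 0 ≤ c * ‖x‖).trans (hcN x)
      exact mul_le_one₀ ha1 this hx
  · intro u hu
    rw [radialFunction_sublevel hpos hhom hu]
    exact inv_pos.2 (hpos u hu)
  · exact (hc.inv₀ fun x hx => (hpos x hx).ne').congr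
      fun x hx => radialFunction_sublevel hpos hhom hx

lemma subadditive_of_convex_sublevel {N : E → ℝ} (hpos : ∀ x, x ≠ 0 → 0 < N x)
    (hhom : ∀ (t : ℝ) (x : E), 0 < t → N (t • x) = t * N x)
    (hconv : Convex ℝ {x | N x ≤ 1}) {x y : E} (hx : x ≠ 0) (hy : y ≠ 0) :
    N (x + y) ≤ N x + N y := by
  have hx' := hpos x hx
  have hy' := hpos y hy
  have hs : 0 < N x + N y := add_pos hx' hy'
  have key : ∀ z, z ≠ 0 → (N z)⁻¹ • z ∈ {x | N x ≤ 1} := by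
    intro z hz
    rw [Set.mem_ofPred_eq, hhom _ _ (inv_pos.2 (hpos z hz)), inv_mul_cancel₀ (hpos z hz).ne']
  -- With these weights the convex combination of the normalised points is `(x + y) / (N x + N y)`.
  have := hconv (key x hx) (key y hy) (a := N x / (N x + N y)) (b := N y / (N x + N y))
    (by positivity) (by positivity) (by field_simp)
  rw [smul_smul, smul_smul, div_mul_eq_mul_div, div_mul_eq_mul_div, mul_inv_cancel₀ hx'.ne',
    mul_inv_cancel₀ hy'.ne', ← smul_add, Set.mem_ofPred_eq, hhom _ _ (by positivity),
    one_div, inv_mul_le_iff₀ hs, mul_one] at this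
  exact this

end Gauge

/-! ### Local integrability of powers of a complex coordinate -/

lemma integrableOn_norm_rpow {q : ℝ} (hq : -2 < q) (R : ℝ) :
    IntegrableOn (fun w : ℂ => ‖w‖ ^ q) (Metric.closedBall 0 R) := by
  rw [← integrable_indicator_iff Metric.isClosed_closedBall.measurableSet]
  have h : (Metric.closedBall (0 : ℂ) R).indicator (fun w : ℂ => ‖w‖ ^ q) =
      fun w => (Set.Iic R).indicator (fun r : ℝ => r ^ q) ‖w‖ := by
    ext w
    by_cases hw : ‖w‖ ≤ R
    · rw [Set.indicator_of_mem (mem_closedBall_zero_iff.2 hw), Set.indicator_of_mem (Set.mem_Iic.2 hw)]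
    · rw [Set.indicator_of_notMem (mt mem_closedBall_zero_iff.1 hw), 
        Set.indicator_of_notMem (mt Set.mem_Iic.1 hw)]
  -- In polar coordinates the integrand becomes `r ^ (q + 1)`, integrable at `0` exactly because `q
  -- > -2`.
  rw [h, integrable_fun_norm_addHaar (volume : Measure ℂ), Complex.finrank_real_complex]
  have h1 : IntegrableOn (fun r : ℝ => r ^ (q + 1)) (Set.Ioc 0 (max R 0)) := by
    rw [← intervalIntegrable_iff_integrableOn_Ioc_of_le (le_max_right _ _)]
    exact intervalIntegral.intervalIntegrable_rpow' (by linarith)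
  rw [← integrable_indicator_iff measurableSet_Ioi]
  rw [← integrable_indicator_iff measurableSet_Ioc] at h1
  convert h1 using 1
  ext r
  simp only [Set.indicator_apply, Set.mem_Ioi, Set.mem_Ioc, Set.mem_Iic]
  by_cases hr : 0 < r
  · by_cases hR : r ≤ R
    · simp [hr, hR, Real.rpow_add_one hr.ne', mul_comm]
    · simp [hr, hR, hr.not_ge]
  · simp [hr]

variable {n : ℕ}

lemma integrableOn_norm_coord_rpow {q : ℝ} (hq : -2 < q) (R : ℝ) (j : Fin n) :
    IntegrableOn (fun x : Cn n => ‖x j‖ ^ q) (Metric.closedBall 0 R) := by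
  let e := PiLp.continuousLinearEquiv 2 ℝ (fun _ : Fin n => ℂ)
  have he : MeasurableEmbedding e := e.toHomeomorph.measurableEmbedding
  have hpi : IntegrableOn (fun x : Fin n → ℂ => ‖x j‖ ^ q)
      (Set.univ.pi fun _ => Metric.closedBall 0 R) := by
    rw [IntegrableOn, volume_pi, Measure.restrict_pi_pi]
    have hfin : IsFiniteMeasure ((volume : Measure ℂ).restrict (Metric.closedBall 0 R)) :=
      isFiniteMeasure_restrict.2 (isCompact_closedBall (0 : ℂ) R).measure_lt_top.ne
    have hm := Measure.pi_map_eval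
      (fun _ : Fin n => (volume : Measure ℂ).restrict (Metric.closedBall 0 R)) j
    have hi : Integrable (fun w : ℂ => ‖w‖ ^ q)
        (Measure.map (Function.eval j) (Measure.pi
          (fun _ : Fin n => (volume : Measure ℂ).restrict (Metric.closedBall 0 R)))) := by
      rw [hm]
      exact (integrableOn_norm_rpow hq R).smul_measure
        (ENNReal.prod_ne_top fun i _ => measure_ne_top _ _)
    exact hi.comp_measurable (measurable_pi_apply j)
  -- Uniqueness of Haar measure gives a scalar multiple of the product measure; its value is
  -- irrelevant for integrability.
  have hmap : Measure.map e (volume : Measure (Cn n)) =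
      (Measure.map e (volume : Measure (Cn n))).addHaarScalarFactor volume •
        (volume : Measure (Fin n → ℂ)) :=
    Measure.isAddLeftInvariant_eq_smul _ _
  have h1 : IntegrableOn (fun x : Fin n → ℂ => ‖x j‖ ^ q)
      (Set.univ.pi fun _ => Metric.closedBall 0 R) (Measure.map e (volume : Measure (Cn n))) := by
    rw [hmap, IntegrableOn, Measure.restrict_smul]
    exact Integrable.smul_measure_nnreal hpi
  rw [he.integrableOn_map_iff] at h1
  refine IntegrableOn.mono_set h1 fun x hx => ?_
  simp only [Set.mem_preimage, Set.mem_pi, Set.mem_univ, true_implies, mem_closedBall_zero_iff]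
    at hx ⊢
  exact fun i => (PiLp.norm_apply_le x i).trans hx

/-- Coordinates in an orthonormal basis whose `j`-th vector is `u`. This reduces every unit
direction to a coordinate, making the integral bounds uniform in `u`. -/
lemma exists_linearIsometryEquiv_inner (j : Fin n) {u : Cn n} (hu : ‖u‖ = 1) :
    ∃ e : Cn n ≃ₗᵢ[ℝ] Cn n, ∀ x, inner ℂ u x = e x j := by
  obtain ⟨b, hb⟩ := Orthonormal.exists_orthonormalBasis_extension_of_card_eq (𝕜 := ℂ)
    (E := Cn n) (ι := Fin n) (by simp) (v := fun _ => u) (s := {j}) (by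
      rw [orthonormal_iff_ite]
      rintro ⟨i, rfl⟩ ⟨i', rfl⟩
      simp [Set.domRestrict, inner_self_eq_norm_sq_to_K, hu])
  refine ⟨⟨b.repr.toLinearEquiv.restrictScalars ℝ, b.repr.norm_map⟩, fun x => ?_⟩
  have := b.repr_apply_apply x j
  rw [hb j rfl] at this
  exact this.symm

lemma integrableOn_norm_inner_rpow {q : ℝ} (hq : -2 < q) (R : ℝ) (j : Fin n) {u : Cn n}
    (hu : ‖u‖ = 1) :
    IntegrableOn (fun x : Cn n => ‖(inner ℂ u x : ℂ)‖ ^ q) (Metric.closedBall 0 R) ∧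
    ∫ x in Metric.closedBall 0 R, ‖(inner ℂ u x : ℂ)‖ ^ q =
      ∫ x : Cn n in Metric.closedBall 0 R, ‖x j‖ ^ q := by
  obtain ⟨e, he⟩ := exists_linearIsometryEquiv_inner j hu
  have hpre : e ⁻¹' Metric.closedBall 0 R = Metric.closedBall 0 R := by
    ext x
    simp
  have hm := e.measurePreserving
  have hme : MeasurableEmbedding e := e.toHomeomorph.measurableEmbedding
  constructor
  · have := (hm.integrableOn_comp_preimage hme).2 (integrableOn_norm_coord_rpow hq R j)
    rw [hpre] at this
    simpa [Function.comp_def, he] using this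
  · have := hm.setIntegral_preimage_emb hme (fun x : Cn n => ‖x j‖ ^ q) (Metric.closedBall 0 R)
    rw [hpre] at this
    simpa [he] using this

lemma ae_inner_ne_zero {u : Cn n} (hu : u ≠ 0) : ∀ᵐ x : Cn n, (inner ℂ u x : ℂ) ≠ 0 := by
  let S : Submodule ℝ (Cn n) := ((innerSL ℂ u).restrictScalars ℝ).ker
  have hS : volume (S : Set (Cn n)) = 0 := by
    refine Measure.addHaar_submodule _ S fun h => hu ?_
    have : u ∈ S := h ▸ Submodule.mem_top
    simpa [S] using this
  refine (ae_iff (p := fun x : Cn n => (inner ℂ u x : ℂ) ≠ 0)).2 ?_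
  convert hS using 2
  ext x
  simp [S]

/-! ### The power integral, its continuity and the intersection body -/

/-- The integral `∫_K h_{Cu}(x) ^ p dx` for the triangle `C` with vertices `1`, `i`, `-1 - i`. -/
def supportPowerIntegral (p : ℝ) (K : Set (Cn n)) (u : Cn n) : ℝ :=
  ∫ x in K, triangleSupport (inner ℂ u x) ^ p

lemma measurable_triangleSupport_rpow (p : ℝ) :
    Measurable fun w : ℂ => triangleSupport w ^ p :=
  continuous_triangleSupport.measurable.pow_const p

lemma measurable_triangleSupport_inner_rpow (p : ℝ) (u : Cn n) :
    Measurable fun x : Cn n => triangleSupport (inner ℂ u x) ^ p :=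
  (measurable_triangleSupport_rpow p).comp (by fun_prop : Continuous _).measurable

lemma integrableOn_triangleSupport_inner_rpow {p : ℝ} (hp : -2 < p) {K : Set (Cn n)} {R : ℝ}
    (hK : K ⊆ Metric.closedBall 0 R) (j : Fin n) {u : Cn n} (hu : ‖u‖ = 1) :
    IntegrableOn (fun x => triangleSupport (inner ℂ u x) ^ p) K := by
  have h := (integrableOn_norm_inner_rpow hp R j hu).1.mono_set hK
  refine (h.const_mul (4 ^ |p|)).mono' (measurable_triangleSupport_inner_rpow p u).aestronglyMeasurable ?_
  refine Eventually.of_forall fun x => ?_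
  rw [Real.norm_of_nonneg (Real.rpow_nonneg (triangleSupport_nonneg _) _)]
  exact triangleSupport_rpow_le p _

/-- Controls the truncation error at height `m`. The exponent `3/2` is affordable: `p ≥ -1` gives `p
* (3/2) ≥ -3/2 > -2`, so the larger power is still locally integrable. -/
lemma sub_min_le_rpow_mul {x m : ℝ} (hx : 0 ≤ x) (hm : 0 < m) :
    x - min x m ≤ x ^ (3 / 2 : ℝ) * m ^ (-(1 / 2) : ℝ) := by
  rcases le_total x m with h | h
  · rw [min_eq_left h, sub_self]
    positivity
  · have hx' : 0 < x := hm.trans_le h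
    rw [min_eq_right h]
    have h1 : x ^ (-(1 / 2) : ℝ) ≤ m ^ (-(1 / 2) : ℝ) :=
      Real.rpow_le_rpow_of_nonpos hm h (by norm_num)
    have h2 : x ^ (3 / 2 : ℝ) * x ^ (-(1 / 2) : ℝ) = x := by
      rw [← Real.rpow_add hx']
      norm_num
    have := mul_le_mul_of_nonneg_left h1 (Real.rpow_nonneg hx (3 / 2 : ℝ))
    linarith

lemma continuousOn_integral_min {p : ℝ} {K : Set (Cn n)} {R : ℝ}
    (hK : K ⊆ Metric.closedBall 0 R) {m : ℝ} (hm : 0 < m) :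
    ContinuousOn (fun u : Cn n => ∫ x in K, min (triangleSupport (inner ℂ u x) ^ p) m)
      (Metric.sphere 0 1) := by
  intro u hu
  have hu0 : u ≠ 0 := by
    rintro rfl
    simp at hu
  have hfin : volume K < ⊤ :=
    (measure_mono hK).trans_lt (isCompact_closedBall (0 : Cn n) R).measure_lt_top
  refine ContinuousAt.continuousWithinAt ?_
  refine continuousAt_of_dominated (bound := fun _ => m) (Eventually.of_forall fun v => ?_)
    (Eventually.of_forall fun v => Eventually.of_forall fun x => ?_)
    (integrableOn_const hfin.ne) (ae_restrict_of_ae ?_)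
  · exact ((measurable_triangleSupport_inner_rpow p v).min measurable_const).aestronglyMeasurable
  · rw [Real.norm_of_nonneg (le_min (Real.rpow_nonneg (triangleSupport_nonneg _) _) hm.le)]
    exact min_le_right _ _
  · filter_upwards [ae_inner_ne_zero hu0] with x hx
    refine Filter.Tendsto.min (ContinuousAt.rpow_const ?_ (Or.inl (triangleSupport_pos hx).ne'))
      continuousAt_const
    exact (continuous_triangleSupport.comp (by fun_prop : Continuous fun v : Cn n =>
      (inner ℂ v x : ℂ))).continuousAt

lemma continuousOn_supportPowerIntegral {p : ℝ} (hp : -1 ≤ p) {K : Set (Cn n)} {R : ℝ}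
    (hK : K ⊆ Metric.closedBall 0 R) (j : Fin n) :
    ContinuousOn (supportPowerIntegral p K) (Metric.sphere 0 1) := by
  set B : ℝ := 4 ^ |p * (3 / 2)| * ∫ x : Cn n in Metric.closedBall 0 R, ‖x j‖ ^ (p * (3 / 2))
    with hB
  have hfin : volume K < ⊤ :=
    (measure_mono hK).trans_lt (isCompact_closedBall (0 : Cn n) R).measure_lt_top
  have key : ∀ (m : ℝ), 0 < m → ∀ u ∈ Metric.sphere (0 : Cn n) 1,
      |supportPowerIntegral p K u - ∫ x in K, min (triangleSupport (inner ℂ u x) ^ p) m| ≤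
        B * m ^ (-(1 / 2) : ℝ) := by
    intro m hm u hu
    rw [mem_sphere_zero_iff_norm] at hu
    have i1 := integrableOn_triangleSupport_inner_rpow (by linarith : -2 < p) hK j hu
    have i2 : IntegrableOn (fun x => min (triangleSupport (inner ℂ u x) ^ p) m) K :=
      Integrable.inf i1 (integrableOn_const hfin.ne)
    have i3 := integrableOn_triangleSupport_inner_rpow (by linarith : -2 < p * (3 / 2)) hK j hu
    obtain ⟨i4, e4⟩ := integrableOn_norm_inner_rpow (by linarith : -2 < p * (3 / 2)) R j hu
    rw [supportPowerIntegral, ← integral_sub i1 i2, abs_of_nonneg (integral_nonneg fun x =>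
      sub_nonneg.2 (min_le_left _ _))]
    calc ∫ x in K, (triangleSupport (inner ℂ u x) ^ p - min (triangleSupport (inner ℂ u x) ^ p) m)
        ≤ ∫ x in K, triangleSupport (inner ℂ u x) ^ (p * (3 / 2)) * m ^ (-(1 / 2) : ℝ) := by
          refine integral_mono (i1.sub i2) (i3.mul_const _) fun x => ?_
          have := sub_min_le_rpow_mul (Real.rpow_nonneg (triangleSupport_nonneg (inner ℂ u x)) p) hm
          rwa [← Real.rpow_mul (triangleSupport_nonneg _)] at this
      _ = (∫ x in K, triangleSupport (inner ℂ u x) ^ (p * (3 / 2))) * m ^ (-(1 / 2) : ℝ) :=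
          integral_mul_const _ _
      _ ≤ B * m ^ (-(1 / 2) : ℝ) := by
          refine mul_le_mul_of_nonneg_right ?_ (by positivity)
          rw [hB, ← e4, ← integral_const_mul]
          calc _ ≤ ∫ x in K, 4 ^ |p * (3 / 2)| * ‖(inner ℂ u x : ℂ)‖ ^ (p * (3 / 2)) :=
                integral_mono i3 ((i4.mono_set hK).const_mul _)
                  fun x => triangleSupport_rpow_le _ _
            _ ≤ _ := setIntegral_mono_set (i4.const_mul _)
                (Eventually.of_forall fun x => by positivity) hK.eventuallyLE
  have hlim : Tendsto (fun m : ℝ => B * m ^ (-(1 / 2) : ℝ)) atTop (𝓝 0) := by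
    simpa using (tendsto_rpow_neg_atTop (by norm_num : (0 : ℝ) < 1 / 2)).const_mul B
  -- Truncated integrals are continuous by dominated convergence, and by `key` they converge
  -- uniformly on the sphere.
  refine TendstoUniformlyOn.continuousOn (p := (atTop : Filter ℝ))
    (F := fun m u => ∫ x in K, min (triangleSupport (inner ℂ u x) ^ p) m) ?_
    ((eventually_gt_atTop 0).mono fun m hm => continuousOn_integral_min hK hm).frequently
  rw [Metric.tendstoUniformlyOn_iff]
  intro ε hε
  filter_upwards [hlim.eventually_lt_const hε, eventually_gt_atTop 0] with m hm hm0 u hu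
  rw [Real.dist_eq]
  exact (key m hm0 u hu).trans_lt hm

lemma supportPowerIntegral_pos {p : ℝ} (hp : -1 ≤ p) {K : Set (Cn n)} {R : ℝ}
    (hK : K ⊆ Metric.closedBall 0 R) (hK0 : K ∈ 𝓝 0) (j : Fin n)
    {u : Cn n} (hu : ‖u‖ = 1) : 0 < supportPowerIntegral p K u := by
  have hu0 : u ≠ 0 := by
    rintro rfl
    simp at hu
  rw [supportPowerIntegral, setIntegral_pos_iff_support_of_nonneg_ae
    (Eventually.of_forall fun x => Real.rpow_nonneg (triangleSupport_nonneg _) _)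
    (integrableOn_triangleSupport_inner_rpow (by linarith) hK j hu)]
  have : volume (Function.support (fun x => triangleSupport (inner ℂ u x) ^ p) ∩ K) =
      volume K := by
    refine measure_congr ?_
    filter_upwards [ae_inner_ne_zero hu0] with x hx
    refine propext ⟨fun h => h.2, fun h => ⟨?_, h⟩⟩
    exact (Real.rpow_pos_of_pos (triangleSupport_pos hx) _).ne'
  rw [this]
  exact Measure.measure_pos_of_mem_nhds _ hK0

lemma supportPowerIntegral_smul (p : ℝ) (K : Set (Cn n)) {t : ℝ} (ht : 0 ≤ t) (u : Cn n) :
    supportPowerIntegral p K (t • u) = t ^ p * supportPowerIntegral p K u := by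
  rw [supportPowerIntegral, supportPowerIntegral, ← integral_const_mul]
  refine integral_congr_ae (Eventually.of_forall fun x => ?_)
  have : (inner ℂ (t • u) x : ℂ) = t • inner ℂ u x := by
    rw [← Complex.coe_smul, inner_smul_left]
    simp
  simp only [this, triangleSupport_smul ht]
  rw [Real.mul_rpow ht (triangleSupport_nonneg _)]

/-- The gauge of the complex `L_p`-intersection body of `K` for the triangle. -/
def intersectionGauge (p : ℝ) (K : Set (Cn n)) (u : Cn n) : ℝ :=
  supportPowerIntegral p K u ^ p⁻¹

lemma intersectionGauge_smul {p : ℝ} (hp0 : p ≠ 0) (K : Set (Cn n)) (t : ℝ) (u : Cn n)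
    (ht : 0 < t) : intersectionGauge p K (t • u) = t * intersectionGauge p K u := by
  have h : 0 ≤ supportPowerIntegral p K u :=
    integral_nonneg fun x => Real.rpow_nonneg (triangleSupport_nonneg _) _
  rw [intersectionGauge, supportPowerIntegral_smul p K ht.le, Real.mul_rpow (by positivity) h,
    ← Real.rpow_mul ht.le, mul_inv_cancel₀ hp0, Real.rpow_one, intersectionGauge]

lemma intersectionGauge_pos {p : ℝ} (hp : -1 ≤ p) (hp0 : p ≠ 0) {K : Set (Cn n)} {R : ℝ}
    (hK : K ⊆ Metric.closedBall 0 R) (hK0 : K ∈ 𝓝 0) (j : Fin n) (u : Cn n) (hu : u ≠ 0) :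
    0 < intersectionGauge p K u := by
  have hu' : 0 < ‖u‖ := norm_pos_iff.2 hu
  have h1 : ‖‖u‖⁻¹ • u‖ = 1 := by
    rw [norm_smul, norm_inv, norm_norm, inv_mul_cancel₀ hu'.ne']
  have h2 : u = ‖u‖ • (‖u‖⁻¹ • u) := by
    rw [smul_smul, mul_inv_cancel₀ hu'.ne', one_smul]
  rw [h2, intersectionGauge_smul hp0 K _ _ hu']
  exact mul_pos hu' (Real.rpow_pos_of_pos (supportPowerIntegral_pos hp hK hK0 j h1) _)

lemma isComplexLpIntersectionBody_sublevel {p : ℝ} (hp : -1 ≤ p) (hp0 : p ≠ 0) {K : Set (Cn n)}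
    {R : ℝ} (hK : K ⊆ Metric.closedBall 0 R) (hK0 : K ∈ 𝓝 0) (j : Fin n) :
    IsComplexLpIntersectionBody (triangleBody : Set ℂ) p K {u | intersectionGauge p K u ≤ 1} := by
  have hpos := intersectionGauge_pos hp hp0 hK hK0 j
  refine ⟨isStarBody_sublevel hpos ?_ (intersectionGauge_smul hp0 K) ?_, fun u hu => ?_⟩
  -- The convention `0 ^ p = 0` for every `p ≠ 0`, negative ones included, makes the gauge vanish at
  -- the origin.
  · simp [intersectionGauge, supportPowerIntegral, triangleSupport_zero, Real.zero_rpow hp0,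
      Real.zero_rpow (inv_ne_zero hp0)]
  · refine (continuousOn_supportPowerIntegral hp hK j).rpow_const fun u hu => Or.inl ?_
    exact (supportPowerIntegral_pos hp hK hK0 j (mem_sphere_zero_iff_norm.1 hu)).ne'
  · have hu0 : u ≠ 0 := by
      rintro rfl
      simp at hu
    have hF := supportPowerIntegral_pos hp hK hK0 j hu
    rw [radialFunction_sublevel hpos (intersectionGauge_smul hp0 K) hu0,
      Real.inv_rpow (hpos u hu0).le, Real.rpow_neg (hpos u hu0).le, inv_inv, intersectionGauge,
      ← Real.rpow_mul hF.le, inv_mul_cancel₀ hp0, Real.rpow_one]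
    simp only [supportFunction_triangle]
    rfl

/-! ### Origin-symmetric ellipsoids -/

section Ellipsoid

variable {E : Type*} [NormedAddCommGroup E] [InnerProductSpace ℝ E]

lemma image_closedBall_eq (A : E ≃L[ℝ] E) :
    A '' Metric.closedBall (0 : E) 1 = {x | ‖A.symm x‖ ≤ 1} := by
  ext x
  constructor
  · rintro ⟨y, hy, rfl⟩
    simpa using hy
  · intro hx
    exact ⟨A.symm x, mem_closedBall_zero_iff.2 hx, A.apply_symm_apply x⟩

lemma IsOriginSymmetricEllipsoid.isStarBody [FiniteDimensional ℝ E] {K : Set E}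
    (hK : IsOriginSymmetricEllipsoid K) : IsStarBody K := by
  obtain ⟨A, rfl⟩ := hK
  rw [image_closedBall_eq]
  refine isStarBody_sublevel (fun x hx => norm_pos_iff.2 (A.symm.map_ne_zero_iff.2 hx)) (by simp)
    (fun t x ht => ?_) (by fun_prop)
  rw [map_smul, norm_smul, Real.norm_of_nonneg ht.le]

lemma IsOriginSymmetricEllipsoid.convex {K : Set E} (hK : IsOriginSymmetricEllipsoid K) :
    Convex ℝ K := by
  obtain ⟨A, rfl⟩ := hK
  exact (convex_closedBall 0 1).is_linear_image A.isLinear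

lemma IsOriginSymmetricEllipsoid.mem_nhds {K : Set E} (hK : IsOriginSymmetricEllipsoid K) :
    K ∈ 𝓝 0 := by
  obtain ⟨A, rfl⟩ := hK
  have := A.toHomeomorph.isOpenMap.image_mem_nhds (Metric.closedBall_mem_nhds (0 : E) one_pos)
  simpa using this

lemma IsOriginSymmetricEllipsoid.exists_subset_closedBall {K : Set E}
    (hK : IsOriginSymmetricEllipsoid K) : ∃ R, K ⊆ Metric.closedBall 0 R := by
  obtain ⟨A, rfl⟩ := hK
  refine ⟨‖(A : E →L[ℝ] E)‖, ?_⟩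
  rintro _ ⟨y, hy, rfl⟩
  rw [mem_closedBall_zero_iff] at hy ⊢
  exact ((A : E →L[ℝ] E).le_opNorm y).trans
    (mul_le_of_le_one_right (norm_nonneg _) hy)

lemma IsOriginSymmetricEllipsoid.neg_mem_iff {K : Set E} (hK : IsOriginSymmetricEllipsoid K)
    (x : E) : -x ∈ K ↔ x ∈ K := by
  obtain ⟨A, rfl⟩ := hK
  simp [image_closedBall_eq]

end Ellipsoid

/-! ### The long ellipsoids -/

/-- Multiplication by `a` along the real axis of the `j`-th coordinate. -/
def stretchLinearMap (j : Fin n) (a : ℝ) : Cn n →ₗ[ℝ] Cn n where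
  toFun x := x + ((a - 1) * (x j).re) • EuclideanSpace.single j (1 : ℂ)
  map_add' x y := by
    simp only [PiLp.add_apply, Complex.add_re, mul_add, add_smul]
    abel
  map_smul' t x := by
    simp only [PiLp.smul_apply, Complex.smul_re, smul_eq_mul, RingHom.id_apply, smul_add, smul_smul]
    congr 2
    ring

lemma stretchLinearMap_comp (j : Fin n) {a b : ℝ} (h : a * b = 1) (x : Cn n) :
    stretchLinearMap j a (stretchLinearMap j b x) = x := by
  simp only [stretchLinearMap, LinearMap.coe_mk, AddHom.coe_mk, PiLp.add_apply, PiLp.smul_apply,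
    Complex.add_re, Complex.smul_re, PiLp.single_apply, if_true, Complex.one_re,
    smul_eq_mul, mul_one]
  rw [add_assoc, ← add_smul, add_eq_left]
  rw [show (b - 1) * (x j).re + (a - 1) * ((x j).re + (b - 1) * (x j).re) =
    (a * b - 1) * (x j).re by ring, h]
  simp

/-- The invertible real-linear map multiplying the real axis of the `j`-th coordinate by `a`. -/
def stretch (j : Fin n) (a : ℝ) (ha : a ≠ 0) : Cn n ≃L[ℝ] Cn n :=
  LinearEquiv.toContinuousLinearEquiv
    { stretchLinearMap j a with
      invFun := stretchLinearMap j a⁻¹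
      left_inv := stretchLinearMap_comp j (inv_mul_cancel₀ ha)
      right_inv := stretchLinearMap_comp j (mul_inv_cancel₀ ha) }

/-- The unit ball, stretched by the factor `2 (N + 2)` along the real axis of the `j`-th
coordinate. -/
def longEllipsoid (j : Fin n) (N : ℕ) : Set (Cn n) :=
  stretch j (2 * (N + 2)) (by positivity) '' Metric.closedBall 0 1

lemma isOriginSymmetricEllipsoid_longEllipsoid (j : Fin n) (N : ℕ) :
    IsOriginSymmetricEllipsoid (longEllipsoid j N) := ⟨_, rfl⟩

lemma mem_longEllipsoid_iff {j : Fin n} {N : ℕ} {x : Cn n} :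
    x ∈ longEllipsoid j N ↔ ‖stretchLinearMap j (2 * (N + 2) : ℝ)⁻¹ x‖ ≤ 1 := by
  rw [longEllipsoid, image_closedBall_eq]
  rfl

lemma norm_stretchLinearMap_sub_le (j : Fin n) {a : ℝ} (ha : 0 ≤ a) (ha1 : a ≤ 1) (x : Cn n) :
    ‖stretchLinearMap j a x - x‖ ≤ ‖x j‖ := by
  simp only [stretchLinearMap, LinearMap.coe_mk, AddHom.coe_mk, add_sub_cancel_left]
  rw [norm_smul, PiLp.norm_single, norm_one, mul_one, norm_mul, Real.norm_eq_abs,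
    Real.norm_eq_abs]
  refine (mul_le_of_le_one_left (abs_nonneg _) ?_).trans (Complex.abs_re_le_norm _)
  exact abs_le.2 ⟨by linarith, by linarith⟩

lemma inv_two_mul_add_two_mem (N : ℕ) :
    0 ≤ (2 * (N + 2) : ℝ)⁻¹ ∧ (2 * (N + 2) : ℝ)⁻¹ ≤ 1 :=
  ⟨by positivity, inv_le_one_of_one_le₀ (by have : (0 : ℝ) ≤ N := N.cast_nonneg; linarith)⟩

/-- Only the `j`-th coordinate gets long, so the part of the ellipsoid where it is bounded stays in
a ball independent of `N`. -/
lemma mem_closedBall_of_mem_longEllipsoid {j : Fin n} {N : ℕ} {x : Cn n}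
    (hx : x ∈ longEllipsoid j N) {r : ℝ} (hr : ‖x j‖ ≤ r) : x ∈ Metric.closedBall 0 (r + 1) := by
  rw [mem_longEllipsoid_iff] at hx
  obtain ⟨h0, h1⟩ := inv_two_mul_add_two_mem N
  have h2 := norm_stretchLinearMap_sub_le j h0 h1 x
  rw [mem_closedBall_zero_iff]
  have h3 := norm_sub_norm_le x (stretchLinearMap j (2 * (N + 2) : ℝ)⁻¹ x)
  rw [norm_sub_rev] at h3
  linarith

lemma abs_im_le_of_mem_longEllipsoid {j : Fin n} {N : ℕ} {x : Cn n}
    (hx : x ∈ longEllipsoid j N) : |(x j).im| ≤ 1 := by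
  rw [mem_longEllipsoid_iff] at hx
  have h1 := (Complex.abs_im_le_norm _).trans ((PiLp.norm_apply_le _ j).trans hx)
  simpa [stretchLinearMap] using h1

/-- Multiplication by `i` turns the tip of the long axis into a point with imaginary part `2 * (N +
2)`, beyond the bound `1`. -/
lemma not_isCircleInvariant_longEllipsoid (j : Fin n) (N : ℕ) :
    ¬ IsCircleInvariant (longEllipsoid j N) := by
  intro h
  have hN : (0 : ℝ) ≤ N := N.cast_nonneg
  have h1 : EuclideanSpace.single j ((2 * (N + 2) : ℝ) : ℂ) ∈ longEllipsoid j N := by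
    refine ⟨EuclideanSpace.single j 1, by simp, ?_⟩
    change stretchLinearMap j _ _ = _
    ext i
    by_cases hi : i = j
    · subst hi
      simp [stretchLinearMap]
    · simp [stretchLinearMap, hi]
  have h2 : Complex.I • EuclideanSpace.single j ((2 * (N + 2) : ℝ) : ℂ) ∈ longEllipsoid j N := by
    rw [← h Complex.I Complex.norm_I]
    exact Set.smul_mem_smul_set h1
  have h3 := abs_im_le_of_mem_longEllipsoid h2
  simp [-Complex.ofReal_mul] at h3
  rw [abs_of_nonneg (by positivity)] at h3
  linarith

/-- The inverse stretch sends the centre to norm at most `1/2`, and the offset costs at most `1/4 +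
1/4`; this is where the factor `2 * (N + 2)` comes from. -/
lemma ball_subset_longEllipsoid (j : Fin n) {N i : ℕ} (hi : i < N) :
    Metric.closedBall (EuclideanSpace.single j ((i + 2 : ℝ) : ℂ)) (1 / 4) ⊆ longEllipsoid j N := by
  intro x hx
  rw [mem_closedBall_iff_norm] at hx
  obtain ⟨h0, h1⟩ := inv_two_mul_add_two_mem N
  rw [mem_longEllipsoid_iff]
  set a := (2 * (N + 2) : ℝ)⁻¹ with ha
  set c : Cn n := EuclideanSpace.single j ((i + 2 : ℝ) : ℂ) with hc
  have h2 : stretchLinearMap j a c = EuclideanSpace.single j ((a * (i + 2) : ℝ) : ℂ) := by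
    ext k
    by_cases hk : k = j
    · subst hk
      simp [stretchLinearMap, c]
      ring
    · simp [stretchLinearMap, hk, c]
  have h3 : ‖stretchLinearMap j a c‖ ≤ 1 / 2 := by
    rw [h2, PiLp.norm_single, Complex.norm_real, Real.norm_of_nonneg (by positivity),
      ha, ← div_eq_inv_mul, div_le_iff₀ (by positivity)]
    have : (i : ℝ) ≤ N := by exact_mod_cast hi.le
    linarith
  have h4 := norm_stretchLinearMap_sub_le j h0 h1 (x - c)
  have h5 : stretchLinearMap j a x =
      stretchLinearMap j a c + ((stretchLinearMap j a (x - c) - (x - c)) + (x - c)) := by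
    rw [map_sub]
    abel
  rw [h5]
  have h6 := PiLp.norm_apply_le (x - c) j
  linarith [norm_add_le (stretchLinearMap j a c)
    ((stretchLinearMap j a (x - c) - (x - c)) + (x - c)),
    norm_add_le (stretchLinearMap j a (x - c) - (x - c)) (x - c)]

/-! ### Asymptotics as the ellipsoids get longer -/

lemma integrableOn_longEllipsoid {p : ℝ} (hp : -1 ≤ p) (j : Fin n) (N : ℕ) :
    IntegrableOn (fun x : Cn n => ‖x j‖ ^ p) (longEllipsoid j N) := by
  obtain ⟨R, hR⟩ := (isOriginSymmetricEllipsoid_longEllipsoid j N).exists_subset_closedBall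
  exact (integrableOn_norm_coord_rpow (by linarith) R j).mono_set hR

/-- Disjoint balls of equal volume along the long axis give a harmonic lower bound. Centres start at
`2`, so `‖x j‖ ≥ 1` on each ball and `‖x j‖ ^ p ≥ ‖x j‖⁻¹`. -/
lemma tendsto_integral_longEllipsoid {p : ℝ} (hp : -1 ≤ p) (j : Fin n) :
    Tendsto (fun N => ∫ x in longEllipsoid j N, ‖x j‖ ^ p) atTop atTop := by
  set V : ℝ := volume.real (Metric.closedBall (0 : Cn n) (1 / 4)) with hV
  have hV0 : 0 < V := ENNReal.toReal_pos (Metric.measure_closedBall_pos _ _ (by norm_num)).ne'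
    (isCompact_closedBall _ _).measure_lt_top.ne
  refine tendsto_atTop_mono (fun N => ?_)
    (Real.tendsto_sum_range_one_div_nat_succ_atTop.const_mul_atTop
      (by positivity : 0 < V / 3))
  set B : ℕ → Set (Cn n) := fun i =>
    Metric.closedBall (EuclideanSpace.single j ((i + 2 : ℝ) : ℂ)) (1 / 4) with hB
  have hint := integrableOn_longEllipsoid hp j N
  have hsub : ∀ i ∈ Finset.range N, B i ⊆ longEllipsoid j N :=
    fun i hi => ball_subset_longEllipsoid j (Finset.mem_range.1 hi)
  have hcoord : ∀ i, ∀ x ∈ B i, |(x j).re - (i + 2)| ≤ 1 / 4 ∧ |‖x j‖ - (i + 2)| ≤ 1 / 4 := by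
    intro i x hx
    rw [mem_closedBall_iff_norm] at hx
    have h1 := (PiLp.norm_apply_le (x - EuclideanSpace.single j ((i + 2 : ℝ) : ℂ)) j).trans hx
    simp only [PiLp.sub_apply, PiLp.single_apply, if_true] at h1
    constructor
    · simpa using (Complex.abs_re_le_norm _).trans h1
    · have := (abs_norm_sub_norm_le _ _).trans h1
      rwa [Complex.norm_real, Real.norm_of_nonneg (by positivity)] at this
  have hdisj : Set.Pairwise (Finset.range N : Set ℕ) (Function.onFun Disjoint B) := by
    intro i _ k _ hik
    refine Set.disjoint_left.2 fun x hx hx' => hik ?_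
    have h1 := abs_le.1 (hcoord i x hx).1
    have h2 := abs_le.1 (hcoord k x hx').1
    have h3 : (i : ℝ) < k + 1 := by linarith [h1.1, h2.2]
    have h4 : (k : ℝ) < i + 1 := by linarith [h1.2, h2.1]
    have h3' : i < k + 1 := by exact_mod_cast h3
    have h4' : k < i + 1 := by exact_mod_cast h4
    omega
  have hmeas : ∀ i, MeasurableSet (B i) := fun i => Metric.isClosed_closedBall.measurableSet
  calc V / 3 * ∑ i ∈ Finset.range N, 1 / ((i : ℝ) + 1)
      ≤ ∑ i ∈ Finset.range N, ∫ x in B i, ‖x j‖ ^ p := by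
        rw [Finset.mul_sum]
        refine Finset.sum_le_sum fun i hi => ?_
        have hVi : volume.real (B i) = V := by
          simp only [hB, hV, measureReal_def]
          rw [Measure.addHaar_closedBall_center]
        calc V / 3 * (1 / ((i : ℝ) + 1)) ≤ ∫ x in B i, 1 / ((i : ℝ) + 3) := by
              rw [setIntegral_const, hVi, smul_eq_mul, div_mul_div_comm, mul_one, mul_one_div]
              exact div_le_div_of_nonneg_left hV0.le (by positivity)
                (by have : (0 : ℝ) ≤ i := i.cast_nonneg
                    linarith)
          _ ≤ ∫ x in B i, ‖x j‖ ^ p := by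
              refine setIntegral_mono_on (integrableOn_const
                (isCompact_closedBall _ _).measure_lt_top.ne) (hint.mono_set (hsub i hi))
                (hmeas i) fun x hx => ?_
              have h1 := abs_le.1 (hcoord i x hx).2
              have hi0 : (0 : ℝ) ≤ i := i.cast_nonneg
              have hx1 : 1 ≤ ‖x j‖ := by linarith [h1.1]
              calc 1 / ((i : ℝ) + 3) ≤ 1 / ‖x j‖ :=
                    one_div_le_one_div_of_le (by linarith) (by linarith [h1.2])
                _ = ‖x j‖ ^ (-1 : ℝ) := by rw [Real.rpow_neg_one, one_div]
                _ ≤ ‖x j‖ ^ p := Real.rpow_le_rpow_of_exponent_le hx1 hp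
    _ = ∫ x in ⋃ i ∈ Finset.range N, B i, ‖x j‖ ^ p :=
        (integral_biUnion_finset _ (fun i _ => hmeas i) hdisj
          fun i hi => hint.mono_set (hsub i hi)).symm
    _ ≤ ∫ x in longEllipsoid j N, ‖x j‖ ^ p :=
        setIntegral_mono_set hint (Eventually.of_forall fun x => by positivity)
          (Set.iUnion₂_subset hsub).eventuallyLE

/-- A unit complex number with small imaginary part is close to `1` or `-1`, since `1 - |w.re| ≤
w.im ^ 2`. -/
lemma exists_abs_le_of_abs_im_lt {g : ℂ → ℝ} (h1 : ContinuousAt g 1) (h2 : ContinuousAt g (-1))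
    (g1 : g 1 = 0) (g2 : g (-1) = 0) {η : ℝ} (hη : 0 < η) :
    ∃ δ > 0, ∀ w : ℂ, ‖w‖ = 1 → |w.im| < δ → |g w| ≤ η := by
  obtain ⟨d1, hd1, H1⟩ := Metric.continuousAt_iff.1 h1 η hη
  obtain ⟨d2, hd2, H2⟩ := Metric.continuousAt_iff.1 h2 η hη
  rw [g1] at H1
  rw [g2] at H2
  refine ⟨min 1 (min d1 d2 / 2), by positivity, fun w hw him => ?_⟩
  obtain ⟨hi1, hi2⟩ := lt_min_iff.1 him
  have hsq : w.re ^ 2 + w.im ^ 2 = 1 := by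
    have h := Complex.sq_norm_sub_sq_re w
    rw [hw] at h
    linarith
  have him2 : w.im ^ 2 ≤ |w.im| := by
    rw [← sq_abs]
    nlinarith [abs_nonneg w.im]
  rcases le_total 0 w.re with hre | hre
  · have hd : dist w 1 < d1 := by
      rw [dist_eq_norm]
      refine (Complex.norm_le_abs_re_add_abs_im _).trans_lt ?_
      have h3 : |(w - 1).re| ≤ |w.im| := by
        rw [Complex.sub_re, Complex.one_re, abs_le]
        constructor <;> nlinarith
      have h4 : |(w - 1).im| = |w.im| := by simp
      linarith [min_le_left d1 d2]
    simpa using (H1 hd).le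
  · have hd : dist w (-1) < d2 := by
      rw [dist_eq_norm]
      refine (Complex.norm_le_abs_re_add_abs_im _).trans_lt ?_
      have h3 : |(w - -1).re| ≤ |w.im| := by
        rw [Complex.sub_re, Complex.neg_re, Complex.one_re, abs_le]
        constructor <;> nlinarith
      have h4 : |(w - -1).im| = |w.im| := by simp
      linarith [min_le_right d1 d2]
    simpa using (H2 hd).le

/-- Integrals over long ellipsoids only see the long axis, up to a bounded error. -/
lemma exists_abs_integral_longEllipsoid_le {p : ℝ} (hp : -1 ≤ p) (j : Fin n) {g : ℂ → ℝ} {B : ℝ}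
    (hgm : Measurable g) (hgB : ∀ w, |g w| ≤ B * ‖w‖ ^ p)
    (hhom : ∀ (t : ℝ) (w : ℂ), 0 < t → g (t • w) = t ^ p * g w)
    (h1 : ContinuousAt g 1) (h2 : ContinuousAt g (-1)) (g1 : g 1 = 0) (g2 : g (-1) = 0)
    {η : ℝ} (hη : 0 < η) :
    ∃ C, ∀ N, |∫ x in longEllipsoid j N, g (x j)| ≤
      η * (∫ x in longEllipsoid j N, ‖x j‖ ^ p) + C := by
  obtain ⟨δ, hδ, hgδ⟩ := exists_abs_le_of_abs_im_lt h1 h2 g1 g2 hη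
  set D : Set (Cn n) := Metric.closedBall 0 (δ⁻¹ + 1)
  have hB : 0 ≤ B := by simpa using (abs_nonneg _).trans (hgB 1)
  have hD : IntegrableOn (fun x : Cn n => B * ‖x j‖ ^ p) D :=
    (integrableOn_norm_coord_rpow (by linarith) _ j).const_mul B
  have hDm : MeasurableSet D := Metric.isClosed_closedBall.measurableSet
  have hD' : Integrable (D.indicator fun x : Cn n => B * ‖x j‖ ^ p) :=
    (integrable_indicator_iff hDm).2 hD
  refine ⟨∫ x in D, B * ‖x j‖ ^ p, fun N => ?_⟩
  have hint := integrableOn_longEllipsoid hp j N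
  have hKm : MeasurableSet (longEllipsoid j N) :=
    (isOriginSymmetricEllipsoid_longEllipsoid j N).isStarBody.isCompact.isClosed.measurableSet
  have hpt : ∀ x ∈ longEllipsoid j N, |g (x j)| ≤
      η * ‖x j‖ ^ p + D.indicator (fun x : Cn n => B * ‖x j‖ ^ p) x := by
    intro x hx
    -- Near the origin the crude bound on the fixed ball `D` applies. Otherwise `|(x j).im| ≤ 1 < δ
    -- * ‖x j‖`, so the direction of `x j` is nearly real and `g` is small there.
    by_cases hxr : ‖x j‖ ≤ δ⁻¹
    · rw [Set.indicator_of_mem (mem_closedBall_of_mem_longEllipsoid hx hxr)]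
      have := hgB (x j)
      have : 0 ≤ η * ‖x j‖ ^ p := by positivity
      linarith
    · push Not at hxr
      have hx0 : 0 < ‖x j‖ := (inv_pos.2 hδ).trans hxr
      have h3 : |g (‖x j‖⁻¹ • x j)| ≤ η := by
        refine hgδ _ (by rw [norm_smul, norm_inv, norm_norm, inv_mul_cancel₀ hx0.ne']) ?_
        rw [Complex.smul_im, smul_eq_mul, abs_mul, abs_of_pos (inv_pos.2 hx0)]
        refine (mul_le_of_le_one_right (inv_pos.2 hx0).le
          (abs_im_le_of_mem_longEllipsoid hx)).trans_lt ?_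
        exact inv_lt_of_inv_lt₀ hδ hxr
      have h4 : g (x j) = ‖x j‖ ^ p * g (‖x j‖⁻¹ • x j) := by
        rw [← hhom _ _ hx0, smul_smul, mul_inv_cancel₀ hx0.ne', one_smul]
      have h5 : 0 ≤ D.indicator (fun x : Cn n => B * ‖x j‖ ^ p) x :=
        Set.indicator_nonneg (fun x _ => by positivity) x
      rw [h4, abs_mul, abs_of_nonneg (by positivity : 0 ≤ ‖x j‖ ^ p), mul_comm]
      have := mul_le_mul_of_nonneg_right h3 (by positivity : 0 ≤ ‖x j‖ ^ p)
      linarith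
  have hgi : IntegrableOn (fun x : Cn n => g (x j)) (longEllipsoid j N) := by
    refine (hint.const_mul B).mono' ?_ (Eventually.of_forall fun x => hgB (x j))
    exact (hgm.comp (by fun_prop : Continuous fun x : Cn n => x j).measurable).aestronglyMeasurable
  calc |∫ x in longEllipsoid j N, g (x j)| ≤ ∫ x in longEllipsoid j N, |g (x j)| :=
        abs_integral_le_integral_abs
    _ ≤ ∫ x in longEllipsoid j N, (η * ‖x j‖ ^ p +
          D.indicator (fun x : Cn n => B * ‖x j‖ ^ p) x) :=
        setIntegral_mono_on hgi.abs ((hint.const_mul η).add hD'.integrableOn) hKm hpt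
    _ = η * (∫ x in longEllipsoid j N, ‖x j‖ ^ p) +
          ∫ x in longEllipsoid j N, D.indicator (fun x : Cn n => B * ‖x j‖ ^ p) x := by
        rw [integral_add (hint.const_mul η) hD'.integrableOn, integral_const_mul]
    _ ≤ _ := by
        refine add_le_add le_rfl ?_
        rw [← integral_indicator hDm]
        exact setIntegral_le_integral hD'
          (Eventually.of_forall (Set.indicator_nonneg fun x _ => by positivity))

lemma supportPowerIntegral_neg (p : ℝ) {K : Set (Cn n)} (hK : IsOriginSymmetricEllipsoid K)
    (u : Cn n) : supportPowerIntegral p K (-u) = supportPowerIntegral p K u := by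
  have h := (Measure.measurePreserving_neg (volume : Measure (Cn n))).setIntegral_preimage_emb
    (Homeomorph.neg (Cn n)).measurableEmbedding
    (fun x => triangleSupport (inner ℂ u x) ^ p) K
  have hpre : Neg.neg ⁻¹' K = K := by
    ext x
    exact hK.neg_mem_iff x
  rw [hpre] at h
  simpa [supportPowerIntegral, inner_neg_left, inner_neg_right] using h

lemma tendsto_supportPowerIntegral_div {p : ℝ} (hp : -1 ≤ p) (j : Fin n) {z : ℂ}
    (hz : z ≠ 0) :
    Tendsto (fun N => supportPowerIntegral p (longEllipsoid j N) (EuclideanSpace.single j z) /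
      ∫ x in longEllipsoid j N, ‖x j‖ ^ p) atTop
      (𝓝 ((triangleSupport (star z) ^ p + triangleSupport (-star z) ^ p) / 2)) := by
  set v := star z
  have hv : v ≠ 0 := star_ne_zero.2 hz
  set H := triangleSupport v ^ p + triangleSupport (-v) ^ p
  set M : ℕ → ℝ := fun N => ∫ x in longEllipsoid j N, ‖x j‖ ^ p
  set F : ℕ → ℝ := fun N =>
    supportPowerIntegral p (longEllipsoid j N) (EuclideanSpace.single j z)
  -- The symmetrised integrand minus its value at `±1`, extended homogeneously. Symmetrising makes
  -- one constant `H` work at both points; it is harmless because the ellipsoid is symmetric.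
  set g : ℂ → ℝ := fun w =>
    triangleSupport (v * w) ^ p + triangleSupport (-v * w) ^ p - H * ‖w‖ ^ p with hg
  have hbound : ∀ (a w : ℂ), triangleSupport (a * w) ^ p ≤ 4 ^ |p| * ‖a‖ ^ p * ‖w‖ ^ p := by
    intro a w
    refine (triangleSupport_rpow_le p _).trans_eq ?_
    rw [norm_mul, Real.mul_rpow (norm_nonneg _) (norm_nonneg _), mul_assoc]
  have hmeas : ∀ a : ℂ, Measurable fun w => triangleSupport (a * w) ^ p := fun a =>
    (measurable_triangleSupport_rpow p).comp (by fun_prop : Continuous fun w => a * w).measurable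
  have hsm : ∀ (a : ℂ) (t : ℝ) (w : ℂ), 0 < t →
      triangleSupport (a * t • w) ^ p = t ^ p * triangleSupport (a * w) ^ p := by
    intro a t w ht
    rw [mul_smul_comm, triangleSupport_smul ht.le, Real.mul_rpow ht.le (triangleSupport_nonneg _)]
  have hca : ∀ (a w : ℂ), a ≠ 0 → w ≠ 0 →
      ContinuousAt (fun w => triangleSupport (a * w) ^ p) w := fun a w ha hw =>
    ContinuousAt.rpow_const (continuous_triangleSupport.comp
      (by fun_prop : Continuous fun w => a * w)).continuousAt
      (Or.inl (triangleSupport_pos (mul_ne_zero ha hw)).ne')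
  have hcg : ∀ w : ℂ, w ≠ 0 → ContinuousAt g w := fun w hw =>
    ((hca v w hv hw).add (hca (-v) w (neg_ne_zero.2 hv) hw)).sub
      (continuousAt_const.mul (continuous_norm.continuousAt.rpow_const
        (Or.inl (norm_ne_zero_iff.2 hw))))
  have hH : 0 ≤ H := add_nonneg (Real.rpow_nonneg (triangleSupport_nonneg _) _)
    (Real.rpow_nonneg (triangleSupport_nonneg _) _)
  have hFg : ∀ N, ∫ x in longEllipsoid j N, g (x j) = 2 * F N - H * M N := by
    intro N
    have hint := integrableOn_longEllipsoid hp j N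
    have hi : ∀ a : ℂ, IntegrableOn (fun x : Cn n => triangleSupport (a * x j) ^ p)
        (longEllipsoid j N) := fun a => by
      refine (hint.const_mul (4 ^ |p| * ‖a‖ ^ p)).mono' ?_ (Eventually.of_forall fun x => ?_)
      · exact ((hmeas a).comp
          (by fun_prop : Continuous fun x : Cn n => x j).measurable).aestronglyMeasurable
      · rw [Real.norm_of_nonneg (Real.rpow_nonneg (triangleSupport_nonneg _) _)]
        exact hbound a (x j)
    have hF : ∀ a : ℂ, supportPowerIntegral p (longEllipsoid j N)
        (EuclideanSpace.single j (star a)) =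
          ∫ x in longEllipsoid j N, triangleSupport (a * x j) ^ p := by
      intro a
      refine integral_congr_ae (Eventually.of_forall fun x => ?_)
      simp [EuclideanSpace.inner_single_left]
    have hF1 : ∫ x in longEllipsoid j N, triangleSupport (v * x j) ^ p = F N := by
      rw [← hF]
      simp [v, F]
    have hF2 : ∫ x in longEllipsoid j N, triangleSupport (-v * x j) ^ p = F N := by
      rw [← hF, ← supportPowerIntegral_neg p (isOriginSymmetricEllipsoid_longEllipsoid j N)]
      rw [← PiLp.single_neg]
      simp [v, F]
    have h1 : ∫ x in longEllipsoid j N, g (x j) =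
        (∫ x in longEllipsoid j N, (triangleSupport (v * x j) ^ p +
          triangleSupport (-v * x j) ^ p)) - ∫ x in longEllipsoid j N, H * ‖x j‖ ^ p :=
      integral_sub ((hi v).add (hi (-v))) (hint.const_mul H)
    rw [h1, integral_add (hi v) (hi (-v)), hF1, hF2, integral_const_mul, two_mul]
  have hM : Tendsto M atTop atTop := tendsto_integral_longEllipsoid hp j
  rw [Metric.tendsto_atTop']
  intro η hη
  obtain ⟨C, hC⟩ := exists_abs_integral_longEllipsoid_le hp j (g := g)
    (B := 4 ^ |p| * ‖v‖ ^ p + 4 ^ |p| * ‖-v‖ ^ p + H)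
    (((hmeas v).add (hmeas (-v))).sub ((measurable_norm.pow_const p).const_mul H))
    (fun w => by
      have h1 := hbound v w
      have h2 := hbound (-v) w
      have h3 := Real.rpow_nonneg (triangleSupport_nonneg (v * w)) p
      have h4 := Real.rpow_nonneg (triangleSupport_nonneg (-v * w)) p
      have h5 : 0 ≤ H * ‖w‖ ^ p := by positivity
      simp only [hg]
      rw [abs_le, add_mul, add_mul]
      constructor <;> linarith)
    (fun t w ht => by
      simp only [hg, hsm v t w ht, hsm (-v) t w ht, norm_smul, Real.norm_of_nonneg ht.le,
        Real.mul_rpow ht.le (norm_nonneg w)]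
      ring)
    (hcg 1 one_ne_zero) (hcg (-1) (neg_ne_zero.2 one_ne_zero))
    (by simp [hg, H]) (by simp [hg, H]; ring) hη
  -- Once `C < η * M N`, the error `η * M N + C` is below `2 * η * M N`, which is what division by
  -- `2 * M N` needs.
  obtain ⟨N₀, hN₀⟩ := eventually_atTop.1
    ((hM.eventually_gt_atTop 0).and (hM.eventually_gt_atTop (C / η)))
  refine ⟨N₀, fun N hN => ?_⟩
  obtain ⟨h0, h1⟩ := hN₀ N hN.le
  have h2 := hC N
  rw [hFg N] at h2
  rw [div_lt_iff₀ hη] at h1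
  have h3 : F N / M N - H / 2 = (2 * F N - H * M N) / (2 * M N) := by
    field_simp
  rw [Real.dist_eq]
  change |F N / M N - H / 2| < η
  rw [h3, abs_div, abs_of_pos (by positivity : 0 < 2 * M N), div_lt_iff₀ (by positivity)]
  change _ ≤ η * M N + C at h2
  linarith

/-! ### Failure of convexity -/

lemma exists_not_convex_sublevel {p : ℝ} (hp : -1 ≤ p) (hp1 : p < 1) (hp0 : p ≠ 0) (j : Fin n) :
    ∃ N, ¬ Convex ℝ {u | intersectionGauge p (longEllipsoid j N) u ≤ 1} := by
  by_contra! hconv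
  set G : ℕ → ℂ → ℝ := fun N z => (supportPowerIntegral p (longEllipsoid j N)
    (EuclideanSpace.single j z) / ∫ x in longEllipsoid j N, ‖x j‖ ^ p) ^ p⁻¹ with hG
  have hsub : ∀ N (z w : ℂ), z ≠ 0 → w ≠ 0 → G N (z + w) ≤ G N z + G N w := by
    intro N z w hz hw
    have hK := isOriginSymmetricEllipsoid_longEllipsoid j N
    obtain ⟨R, hR⟩ := hK.exists_subset_closedBall
    have h := subadditive_of_convex_sublevel
      (intersectionGauge_pos hp hp0 hR hK.mem_nhds j) (intersectionGauge_smul hp0 _) (hconv N)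
      (x := EuclideanSpace.single j z) (y := EuclideanSpace.single j w) (by simpa) (by simpa)
    rw [← PiLp.single_add] at h
    have hM : 0 ≤ ∫ x in longEllipsoid j N, ‖x j‖ ^ p := integral_nonneg fun x => by positivity
    have hF : ∀ u, 0 ≤ supportPowerIntegral p (longEllipsoid j N) u := fun u =>
      integral_nonneg fun x => Real.rpow_nonneg (triangleSupport_nonneg _) _
    simp only [hG, Real.div_rpow (hF _) hM, ← add_div]
    exact div_le_div_of_nonneg_right h (Real.rpow_nonneg hM _)
  have hlim : ∀ z : ℂ, z ≠ 0 → Tendsto (fun N => G N z) atTop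
      (𝓝 (((triangleSupport (star z) ^ p + triangleSupport (-star z) ^ p) / 2) ^ p⁻¹)) := by
    intro z hz
    refine (tendsto_supportPowerIntegral_div hp j hz).rpow_const (Or.inl ?_)
    have h1 := Real.rpow_pos_of_pos (triangleSupport_pos (star_ne_zero.2 hz)) p
    have h2 := Real.rpow_pos_of_pos (triangleSupport_pos (neg_ne_zero.2 (star_ne_zero.2 hz))) p
    positivity
  -- For these two points the support functions of the triangle and of its reflection are both
  -- additive after conjugation, so only the power mean decides.
  have hz : (⟨2, 1⟩ : ℂ) ≠ 0 := fun h => by simpa using congrArg Complex.im h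
  have hw : (⟨1, 2⟩ : ℂ) ≠ 0 := fun h => by simpa using congrArg Complex.re h
  have hzw : (⟨2, 1⟩ : ℂ) + ⟨1, 2⟩ ≠ 0 := fun h => by
    have := congrArg Complex.re h
    norm_num at this
  have hle := le_of_tendsto_of_tendsto' (hlim _ hzw) ((hlim _ hz).add (hlim _ hw))
    fun N => hsub N _ _ hz hw
  have e1 : triangleSupport (star (⟨2, 1⟩ : ℂ)) = 2 := by norm_num [triangleSupport]
  have e2 : triangleSupport (-star (⟨2, 1⟩ : ℂ)) = 1 := by norm_num [triangleSupport]
  have e3 : triangleSupport (star (⟨1, 2⟩ : ℂ)) = 1 := by norm_num [triangleSupport]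
  have e4 : triangleSupport (-star (⟨1, 2⟩ : ℂ)) = 2 := by norm_num [triangleSupport]
  have e5 : triangleSupport (star ((⟨2, 1⟩ : ℂ) + ⟨1, 2⟩)) = 3 := by norm_num [triangleSupport]
  have e6 : triangleSupport (-star ((⟨2, 1⟩ : ℂ) + ⟨1, 2⟩)) = 3 := by norm_num [triangleSupport]
  rw [e1, e2, e3, e4, e5, e6, Real.one_rpow, add_comm 1,
    Real.div_rpow (by positivity) (by norm_num), Real.div_rpow (by positivity) (by norm_num),
    ← add_div, ← two_mul (_ ^ p⁻¹), div_le_div_iff_of_pos_right (by positivity)] at hle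
  exact (not_subadditive_of_lt_one hp1 hp0).not_ge hle

end ComplexLpIntersection

end

theorem mainTheorem9 (n : ℕ) (hn : 1 ≤ n) (p : ℝ) (hp : -1 ≤ p) (hp1 : p < 1) (hp0 : p ≠ 0) :
    ∃ C : ConvexBody ℂ, (0 : ℂ) ∈ interior (C : Set ℂ) ∧
      ComplexLpIntersection.IsTriangle (C : Set ℂ) ∧
      ∃ K : Set (ComplexLpIntersection.Cn n),
        ComplexLpIntersection.IsOriginSymmetricEllipsoid K ∧
        ComplexLpIntersection.IsStarBody K ∧ Convex ℝ K ∧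
        ¬ ComplexLpIntersection.IsCircleInvariant K ∧
        ∃ L : Set (ComplexLpIntersection.Cn n),
          ComplexLpIntersection.IsComplexLpIntersectionBody (C : Set ℂ) p K L ∧
          ¬ Convex ℝ L := by
  have j : Fin n := ⟨0, hn⟩
  obtain ⟨N, hN⟩ := ComplexLpIntersection.exists_not_convex_sublevel hp hp1 hp0 j
  have hK := ComplexLpIntersection.isOriginSymmetricEllipsoid_longEllipsoid j N
  obtain ⟨R, hR⟩ := hK.exists_subset_closedBall
  exact ⟨ComplexLpIntersection.triangleBody, ComplexLpIntersection.zero_mem_interior_triangleBody,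
    ComplexLpIntersection.isTriangle_triangleBody, ComplexLpIntersection.longEllipsoid j N,
    hK, hK.isStarBody, hK.convex, ComplexLpIntersection.not_isCircleInvariant_longEllipsoid j N, _,
    ComplexLpIntersection.isComplexLpIntersectionBody_sublevel hp hp0 hR hK.mem_nhds j, hN⟩
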